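/- Let $B$ be a topological space and $I=[0,1]$. **Conventions.** A fibrewise space over $B$ is a space $X$ with a map $p_X:X\to B$; it is fibrewise pointed if it carries a section $s_X:B\to X$ of $p_X$. Maps over $B$ are fibrewise maps, and fibrewise maps preserving the sections are fibrewise pointed maps. A fibrewise homotopy is a fibrewise map $H:X\times I\to Y$ (with projection $(x,t)\mapsto p_X(x)$); it is pointed if $H(s_X(b),t)=s_Y(b)$ for all $b,t$. A fibrewise cofibration is a fibrewise map with the homotopy extension property for fibrewise maps and fibrewise homotopies into all fibrewise spaces; a fibrewise pointed cofibration is a fibrewise pointed map with the homotopy extension property for fibrewise pointed maps and homotopies into all fibrewise pointed spaces; "closed" means that the map is closed. $\mathbf{Top}_w(B)$ is the category of fibrewise pointed spaces $X$ that are well-pointed, i.e. $s_X:B\to X$ is a closed fibrewise cofibration, and of fibrewise pointed maps. The fibrewise product is $X\times_BY=\{(x,y):p_X(x)=p_Y(y)\}$, with section $(s_X,s_Y)$, and $\prod_B^{m}X$ is the product of $m$ copies of $X$. The join of fibrewise pointed maps $h:Y\to K$ and $k:Z\to K$ is constructed as follows. Let $L$ be the space of all $(y,\theta,z)$, with $y\in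 Y$, $z\in Z$ and $\theta$ a path in a fibre of $K$ (compact-open topology) such that $\theta(0)=h(y)$ and $\theta(1)=k(z)$; its section consists of the triples of base points and constant paths. The join $Y*_KZ$ is the quotient of $Y\sqcup (L\times I)\sqcup Z$ by $((y,\theta,z),0)\sim y$ and $((y,\theta,z),1)\sim z$, with the section $b\mapsto[s_L(b),\tfrac12]$, and the induced map $Y*_KZ\to K$ is $h$ on $Y$, $k$ on $Z$ and $[(y,\theta,z),t]\mapsto\theta(t)$ on the cylinder. Let $f:E\to X$ be a fibrewise pointed map. * $\mathrm{secat}_B^B(f)$ is the least $m\ge 0$ such that $X$ has an open cover $U_0,\dots,U_m$ in which every $U_i$ contains $s_X(B)$ and admits a fibrewise pointed map $\sigma_i:U_i\to E$ with $f\sigma_i$ fibrewise pointed homotopic to the inclusion $U_i\hookrightarrow X$ (and $\infty$ if there is no such $m$). * The fat wedges $j_n:T^n_B(f)\to\prod_B^{n+1}X$ are defined by $j_0=f:E\to X$ and, for $n\ge1$, by letting $j_n$ be the join of $f\times_B\mathrm{id}:E\times_B\prod_B^nX\to\prod_B^{n+1}X$ and $\mathrm{id}\times_Bj_{n-1}:X\times_BT^{n-1}_B(f)\to\prod_B^{n+1}X$.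 * The fibrewise Ganea maps $p_n:G^n_B(f)\to X$ are defined by $p_0=f:E\to X$ and, for $n\ge1$, by letting $p_n$ be the join of $p_{n-1}:G^{n-1}_B(f)\to X$ and $f:E\to X$. **Theorem.** Let $f:E\to X$ be a fibrewise pointed map in $\mathbf{Top}_w(B)$, and suppose that either $E$ and $X$ are normal, or $f$ is a closed fibrewise pointed cofibration and $X$ is normal. Then for every $n\ge0$ the following statements are equivalent: 1. $\mathrm{secat}_B^B(f)\le n$; 2. the diagonal $\Delta_{n+1}:X\to\prod_B^{n+1}X$ factors up to fibrewise pointed homotopy through the $n$-fat wedge: there is a fibrewise pointed map $\varphi:X\to T^n_B(f)$ such that $j_n\varphi$ is fibrewise pointed homotopic to $\Delta_{n+1}$; 3. $p_n$ admits a fibrewise pointed homotopy section: there is a fibrewise pointed map $\sigma:X\to G^n_B(f)$ such that $p_n\sigma$ is fibrewise pointed homotopic to $\mathrm{id}_X$. -/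

import Mathlib

open unitInterval

universe u

/-- A fibrewise space over `B`: a topological space with a (continuous) projection to `B`. -/
structure FibSpace (B : Type u) [TopologicalSpace B] where
  carrier : Type u
  [top : TopologicalSpace carrier]
  proj : C(carrier, B)

attribute [instance] FibSpace.top

namespace FibSpace

variable {B : Type u} [TopologicalSpace B]

/-- The base itself, with the identity as projection. -/
def base (B : Type u) [TopologicalSpace B] : FibSpace B where
  carrier := B
  proj := ContinuousMap.id B

/-- The fibrewise cylinder `I_B(X) = X × I`. -/
def cyl (X : FibSpace B) : FibSpace B where
  carrier := X.carrier × I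
  proj := ⟨fun q => X.proj q.1, by fun_prop⟩

/-- The fibrewise cocylinder `P_B(X)`: pairs `(b, α)` with `α` a path in `X` (compact-open topology)
that is projected to the constant path at `b`. -/
def path (X : FibSpace B) : FibSpace B where
  carrier := {q : B × C(I, X.carrier) // ∀ t, X.proj (q.2 t) = q.1}
  proj := ⟨fun q => q.1.1, by fun_prop⟩

end FibSpace

/-- A fibrewise map over `B`. -/
structure FibMap {B : Type u} [TopologicalSpace B] (X Y : FibSpace B) where
  toMap : C(X.carrier, Y.carrier)
  proj_map : ∀ x, Y.proj (toMap x) = X.proj x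

/-- Fibrewise cofibrations: the homotopy extension property against all fibrewise spaces. -/
def FibMap.IsCofibration {B : Type u} [TopologicalSpace B] {A X : FibSpace B}
    (j : FibMap A X) : Prop :=
  ∀ (Y : FibSpace B) (f : FibMap X Y) (H : FibMap A.cyl Y),
    (∀ a, H.toMap (a, 0) = f.toMap (j.toMap a)) →
    ∃ H' : FibMap X.cyl Y, (∀ x, H'.toMap (x, 0) = f.toMap x) ∧
      ∀ a t, H'.toMap (j.toMap a, t) = H.toMap (a, t)

/-- A fibrewise pointed space over `B`: a fibrewise space with a section of its projection. -/
structure PtdFibSpace (B : Type u) [TopologicalSpace B] extends FibSpace B where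
  sec : C(B, carrier)
  proj_sec : ∀ b, proj (sec b) = b

/-- A fibrewise pointed map. -/
structure PtdFibMap {B : Type u} [TopologicalSpace B] (X Y : PtdFibSpace B) extends
    FibMap X.toFibSpace Y.toFibSpace where
  map_sec : ∀ b, toMap (X.sec b) = Y.sec b

/-- A fibrewise homotopy that is stationary along the section. -/
def FibMap.IsPointedHomotopy {B : Type u} [TopologicalSpace B] {X Y : PtdFibSpace B}
    (H : FibMap X.toFibSpace.cyl Y.toFibSpace) : Prop :=
  ∀ b t, H.toMap (X.sec b, t) = Y.sec b

namespace PtdFibSpace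

variable {B : Type u} [TopologicalSpace B]

/-- The section `s_X : B → X` as a fibrewise map. -/
def secMap (X : PtdFibSpace B) : FibMap (FibSpace.base B) X.toFibSpace where
  toMap := X.sec
  proj_map := X.proj_sec

/-- Fibrewise well-pointed spaces: the section is a closed fibrewise cofibration. -/
def WellPointed (X : PtdFibSpace B) : Prop :=
  IsClosedMap X.sec ∧ X.secMap.IsCofibration

/-- A subspace containing the section, as a fibrewise pointed space. -/
def restrict (X : PtdFibSpace B) (U : Set X.carrier) (hU : ∀ b, X.sec b ∈ U) :
    PtdFibSpace B where
  carrier := U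
  proj := ⟨fun x => X.proj x.1, by fun_prop⟩
  sec := ⟨fun b => ⟨X.sec b, hU b⟩, by fun_prop⟩
  proj_sec := X.proj_sec

/-- The fibrewise product `X ×_B Y`. -/
def prod (X Y : PtdFibSpace B) : PtdFibSpace B where
  carrier := {q : X.carrier × Y.carrier // X.proj q.1 = Y.proj q.2}
  proj := ⟨fun q => X.proj q.1.1, by fun_prop⟩
  sec := ⟨fun b => ⟨(X.sec b, Y.sec b), by simp [X.proj_sec, Y.proj_sec]⟩, by fun_prop⟩
  proj_sec := X.proj_sec

/-- `X.pow n` is the fibrewise product `∏_B^{n+1} X` of `n + 1` copies of `X`. -/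
def pow (X : PtdFibSpace B) : ℕ → PtdFibSpace B
  | 0 => X
  | n + 1 => X.prod (X.pow n)

end PtdFibSpace

namespace PtdFibMap

variable {B : Type u} [TopologicalSpace B]

/-- The identity. -/
def id (X : PtdFibSpace B) : PtdFibMap X X where
  toMap := ContinuousMap.id X.carrier
  proj_map _ := rfl
  map_sec _ := rfl

/-- Composition. -/
def comp {X Y Z : PtdFibSpace B} (g : PtdFibMap Y Z) (f : PtdFibMap X Y) : PtdFibMap X Z where
  toMap := g.toMap.comp f.toMap
  proj_map x := (g.proj_map (f.toMap x)).trans (f.proj_map x)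
  map_sec b := (congrArg g.toMap (f.map_sec b)).trans (g.map_sec b)

/-- The inclusion of a subspace containing the section. -/
def incl (X : PtdFibSpace B) (U : Set X.carrier) (hU : ∀ b, X.sec b ∈ U) :
    PtdFibMap (X.restrict U hU) X where
  toMap := ⟨Subtype.val, continuous_subtype_val⟩
  proj_map _ := rfl
  map_sec _ := rfl

/-- The map `X → Y ×_B Z` with components `f` and `g`. -/
def lift {X Y Z : PtdFibSpace B} (f : PtdFibMap X Y) (g : PtdFibMap X Z) :
    PtdFibMap X (Y.prod Z) where
  toMap := ⟨fun x => ⟨(f.toMap x, g.toMap x), (f.proj_map x).trans (g.proj_map x).symm⟩,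
    by fun_prop⟩
  proj_map x := f.proj_map x
  map_sec b := Subtype.ext (Prod.ext (f.map_sec b) (g.map_sec b))

/-- The map `f ×_B g`. -/
def prodMap {X X' Y Y' : PtdFibSpace B} (f : PtdFibMap X X') (g : PtdFibMap Y Y') :
    PtdFibMap (X.prod Y) (X'.prod Y') where
  toMap := ⟨fun q => ⟨(f.toMap q.1.1, g.toMap q.1.2),
    (f.proj_map q.1.1).trans (q.2.trans (g.proj_map q.1.2).symm)⟩,
    ((f.toMap.continuous.comp (continuous_fst.comp continuous_subtype_val)).prodMk
      (g.toMap.continuous.comp (continuous_snd.comp continuous_subtype_val))).subtype_mk _⟩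
  proj_map q := f.proj_map q.1.1
  map_sec b := Subtype.ext (Prod.ext (f.map_sec b) (g.map_sec b))

/-- The diagonal `Δ_{n+1} : X → ∏_B^{n+1} X`. -/
def diag (X : PtdFibSpace B) : (n : ℕ) → PtdFibMap X (X.pow n)
  | 0 => id X
  | n + 1 => lift (id X) (diag X n)

/-- Fibrewise pointed homotopy between fibrewise pointed maps. -/
def Homotopic {X Y : PtdFibSpace B} (f g : PtdFibMap X Y) : Prop :=
  ∃ H : FibMap X.toFibSpace.cyl Y.toFibSpace, H.IsPointedHomotopy ∧
    (∀ x, H.toMap (x, 0) = f.toMap x) ∧ ∀ x, H.toMap (x, 1) = g.toMap x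

/-- Closed fibrewise pointed cofibrations: closed maps with the homotopy extension property
against all fibrewise pointed spaces, for fibrewise pointed homotopies. -/
def IsClosedPtdCofibration {A X : PtdFibSpace B} (j : PtdFibMap A X) : Prop :=
  IsClosedMap j.toMap ∧
  ∀ (Y : PtdFibSpace B) (f : PtdFibMap X Y) (H : FibMap A.toFibSpace.cyl Y.toFibSpace),
    H.IsPointedHomotopy → (∀ a, H.toMap (a, 0) = f.toMap (j.toMap a)) →
    ∃ H' : FibMap X.toFibSpace.cyl Y.toFibSpace, H'.IsPointedHomotopy ∧
      (∀ x, H'.toMap (x, 0) = f.toMap x) ∧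
      ∀ a t, H'.toMap (j.toMap a, t) = H.toMap (a, t)

/-- `U` is open, contains the section, and over it `f` has a section up to fibrewise pointed
homotopy. -/
def IsPtdSectional {E X : PtdFibSpace B} (f : PtdFibMap E X) (U : Set X.carrier) : Prop :=
  IsOpen U ∧ ∃ (hU : ∀ b, X.sec b ∈ U) (s : PtdFibMap (X.restrict U hU) E),
    (incl X U hU).Homotopic (f.comp s)

/-- The fibrewise pointed sectional category: the least `m` such that `X` is covered by `m + 1`
fibrewise pointed sectional open subsets (`⊤` if there is none). -/
noncomputable def secat {E X : PtdFibSpace B} (f : PtdFibMap E X) : ℕ∞ :=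
  ⨅ (m : ℕ) (_ : ∃ U : Fin (m + 1) → Set X.carrier,
    (∀ i, f.IsPtdSectional (U i)) ∧ (⋃ i, U i) = Set.univ), (m : ℕ∞)

/-- The triples `(y, (b, θ), z)` with `θ` a path in a fibre of `K` from `h y` to `k z`. -/
abbrev HPullbackCarrier {Y Z K : PtdFibSpace B} (h : PtdFibMap Y K) (k : PtdFibMap Z K) : Type u :=
  {q : Y.carrier × K.toFibSpace.path.carrier × Z.carrier //
    h.toMap q.1 = q.2.1.1.2 0 ∧ k.toMap q.2.2 = q.2.1.1.2 1}

/-- The evaluation `P_B(K) × I → K`, `((b, θ), t) ↦ θ t`. -/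
def pathEval (K : PtdFibSpace B) : C(K.toFibSpace.path.carrier × I, K.carrier) where
  toFun q := q.1.1.2 q.2
  continuous_toFun :=
    continuous_eval.comp ((continuous_snd.comp (continuous_subtype_val.comp continuous_fst)).prodMk
      (continuous_snd (X := K.toFibSpace.path.carrier)))

/-- The section of `P_B(K)`: constant paths at base points. -/
def pathSec (K : PtdFibSpace B) : C(B, K.toFibSpace.path.carrier) where
  toFun b := ⟨(b, ContinuousMap.const I (K.sec b)), fun _ => K.proj_sec b⟩
  continuous_toFun := (continuous_id.prodMk
    (ContinuousMap.continuous_const'.comp K.sec.continuous)).subtype_mk _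

/-- The standard fibrewise homotopy pullback of `h : Y → K` and `k : Z → K`: triples
`(y, (b, θ), z)` with `θ` a path in a fibre of `K` from `h y` to `k z`. The section consists of the
constant paths at base points. -/
def hpullback {Y Z K : PtdFibSpace B} (h : PtdFibMap Y K) (k : PtdFibMap Z K) :
    PtdFibSpace B where
  carrier := HPullbackCarrier h k
  proj := K.toFibSpace.path.proj.comp
    ⟨fun q : HPullbackCarrier h k => q.1.2.1,
      continuous_fst.comp (continuous_snd.comp continuous_subtype_val)⟩
  sec := (⟨fun b => ⟨(Y.sec b, pathSec K b, Z.sec b), h.map_sec b, k.map_sec b⟩,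
    (Y.sec.continuous.prodMk ((pathSec K).continuous.prodMk Z.sec.continuous)).subtype_mk _⟩ :
      C(B, HPullbackCarrier h k))
  proj_sec _ := rfl

section hpullback

variable {Y Z K : PtdFibSpace B} (h : PtdFibMap Y K) (k : PtdFibMap Z K)

/-- The projection of the standard homotopy pullback to `Y`. -/
def hpullbackFst : PtdFibMap (hpullback h k) Y where
  toMap := (⟨fun q => q.1.1, continuous_fst.comp continuous_subtype_val⟩ :
    C(HPullbackCarrier h k, Y.carrier))
  proj_map q := by
    change Y.proj q.1.1 = q.1.2.1.1.1
    rw [← q.1.2.1.2 0, ← q.2.1, h.proj_map]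
  map_sec _ := rfl

/-- The projection of the standard homotopy pullback to `Z`. -/
def hpullbackSnd : PtdFibMap (hpullback h k) Z where
  toMap := (⟨fun q => q.1.2.2,
      continuous_snd.comp (continuous_snd.comp continuous_subtype_val)⟩ :
    C(HPullbackCarrier h k, Z.carrier))
  proj_map q := by
    change Z.proj q.1.2.2 = q.1.2.1.1.1
    rw [← q.1.2.1.2 1, ← q.2.2, k.proj_map]
  map_sec _ := rfl

/-- The canonical homotopy `(y, (b, θ), z, t) ↦ θ t`. -/
def hpullbackHomotopy :
    FibMap (hpullback h k).toFibSpace.cyl K.toFibSpace where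
  toMap := ((pathEval K).comp ⟨fun q => (q.1.1.2.1, q.2),
      (continuous_fst.comp (continuous_snd.comp (continuous_subtype_val.comp
        continuous_fst))).prodMk continuous_snd⟩ : C(HPullbackCarrier h k × I, K.carrier))
  proj_map q := q.1.1.2.1.2 q.2

end hpullback

/-- The elementary relations `(x, 0) ∼ f x` and `(x, 1) ∼ g x` on `Y ⊔ (L × I) ⊔ Z`. -/
inductive HPushoutRel {L Y Z : PtdFibSpace B} (f : PtdFibMap L Y) (g : PtdFibMap L Z) :
    Y.carrier ⊕ (L.carrier × I) ⊕ Z.carrier → Y.carrier ⊕ (L.carrier × I) ⊕ Z.carrier → Prop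
  | left (x : L.carrier) : HPushoutRel f g (.inr (.inl (x, 0))) (.inl (f.toMap x))
  | right (x : L.carrier) : HPushoutRel f g (.inr (.inl (x, 1))) (.inr (.inr (g.toMap x)))

/-- The map out of the double mapping cylinder of `f` and `g` that is `α` on `Y`, `H` on the
cylinder and `β` on `Z`. -/
def hpushoutDesc {L Y Z : PtdFibSpace B} (f : PtdFibMap L Y) (g : PtdFibMap L Z)
    {W : Type u} [TopologicalSpace W] (α : C(Y.carrier, W)) (H : C(L.carrier × I, W))
    (β : C(Z.carrier, W)) (h0 : ∀ x, H (x, 0) = α (f.toMap x))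
    (h1 : ∀ x, H (x, 1) = β (g.toMap x)) : C(Quot (HPushoutRel f g), W) :=
  ⟨Quot.lift (Sum.elim α (Sum.elim H β)) (by
      rintro _ _ (x | x)
      · exact h0 x
      · exact h1 x),
    continuous_quot_lift _ (α.continuous.sumElim (H.continuous.sumElim β.continuous))⟩

/-- The fibrewise homotopy pushout `C_{f,g} = (Y ⊔ I_B(L) ⊔ Z)/∼` of `f : L → Y` and `g : L → Z`.
It is the pushout of the mapping cylinders of `f` and `g` along their common free end `L`, which is
the middle `L × {1/2}` of the double mapping cylinder; the section is the one of `L`. -/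
noncomputable def hpushout {L Y Z : PtdFibSpace B} (f : PtdFibMap L Y) (g : PtdFibMap L Z) :
    PtdFibSpace B where
  carrier := Quot (HPushoutRel f g)
  proj := hpushoutDesc f g Y.proj L.toFibSpace.cyl.proj Z.proj
    (fun x => (f.proj_map x).symm) (fun x => (g.proj_map x).symm)
  sec := ⟨fun b => Quot.mk _ (.inr (.inl (L.sec b, ⟨1 / 2, by norm_num, by norm_num⟩))),
    continuous_quot_mk.comp (continuous_inr.comp (continuous_inl.comp
      (L.sec.continuous.prodMk continuous_const)))⟩
  proj_sec b := L.proj_sec b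

/-- The fibrewise join `Y *_K Z` of `h : Y → K` and `k : Z → K`: the homotopy pushout of the
projections of their homotopy pullback. -/
noncomputable def join {Y Z K : PtdFibSpace B} (h : PtdFibMap Y K) (k : PtdFibMap Z K) :
    PtdFibSpace B :=
  hpushout (hpullbackFst h k) (hpullbackSnd h k)

/-- The induced map `Y *_K Z → K`. -/
noncomputable def joinMap {Y Z K : PtdFibSpace B} (h : PtdFibMap Y K) (k : PtdFibMap Z K) :
    PtdFibMap (join h k) K where
  toMap := hpushoutDesc _ _ h.toMap (hpullbackHomotopy h k).toMap k.toMap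
    (fun q => q.2.1.symm) (fun q => q.2.2.symm)
  proj_map := by
    rintro ⟨y | q | z⟩
    · exact h.proj_map y
    · exact (hpullbackHomotopy h k).proj_map q
    · exact k.proj_map z
  map_sec _ := rfl

/-- The `n`-fat wedge of `f : E → X` together with its map to `∏_B^{n+1} X`: it is `f` for `n = 0`,
and the join of `f ×_B id : E ×_B ∏_B^{n+1} X → ∏_B^{n+2} X` and
`id ×_B j_n : X ×_B T^n_B(f) → ∏_B^{n+2} X` for `n + 1`. -/
noncomputable def fatWedgePair {E X : PtdFibSpace B} (f : PtdFibMap E X) :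
    (n : ℕ) → (T : PtdFibSpace B) × PtdFibMap T (X.pow n)
  | 0 => ⟨E, f⟩
  | n + 1 =>
    ⟨join (prodMap f (id (X.pow n))) (prodMap (id X) (fatWedgePair f n).2),
      joinMap (prodMap f (id (X.pow n))) (prodMap (id X) (fatWedgePair f n).2)⟩

/-- The `n`-fat wedge `T^n_B(f)`. -/
noncomputable def fatWedge {E X : PtdFibSpace B} (f : PtdFibMap E X) (n : ℕ) : PtdFibSpace B :=
  (fatWedgePair f n).1

/-- The map `j_n : T^n_B(f) → ∏_B^{n+1} X`. -/
noncomputable def fatWedgeMap {E X : PtdFibSpace B} (f : PtdFibMap E X) (n : ℕ) :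
    PtdFibMap (f.fatWedge n) (X.pow n) :=
  (fatWedgePair f n).2

/-- The `n`-th Ganea space with its map to `X`: it is `f` for `n = 0`, and the join of
`p_n : G^n_B(f) → X` and `f` for `n + 1`. -/
noncomputable def ganeaPair {E X : PtdFibSpace B} (f : PtdFibMap E X) :
    ℕ → (G : PtdFibSpace B) × PtdFibMap G X
  | 0 => ⟨E, f⟩
  | n + 1 => ⟨join (ganeaPair f n).2 f, joinMap (ganeaPair f n).2 f⟩

/-- The `n`-th Ganea space `G^n_B(f)`. -/
noncomputable def ganea {E X : PtdFibSpace B} (f : PtdFibMap E X) (n : ℕ) : PtdFibSpace B :=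
  (ganeaPair f n).1

/-- The `n`-th Ganea map `p_n : G^n_B(f) → X`. -/
noncomputable def ganeaMap {E X : PtdFibSpace B} (f : PtdFibMap E X) (n : ℕ) :
    PtdFibMap (f.ganea n) X :=
  (ganeaPair f n).2

end PtdFibMap

/-! All three statements say that some map `u` lifts, up to fibrewise pointed homotopy, through
another map. They are compared through `LiftOn u h U`, a homotopy lift of `u` through `h` over a
subset `U`. It consists of total functions continuous only on `U`, with the homotopy curried into
the path space, so that restriction is trivial.

The heart of the matter is that lifting through a join amounts to covering by two sets. If `u` lifts
through the join of `h` and `k` over an open set, pulling back height `< 1` and height `> 0` gives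
two open sets covering it. Over these halves the join deforms to its two ends, so `u` lifts through
`h`, respectively `k` (`LiftsOnOpen.of_join`). Conversely, let `u` lift through `h` over an open `U`
and through `k` over an open `V`. On `U ∩ V` the two homotopies join up to a path from one lift to
the other through `u x`, that is, to a point of the homotopy pullback. A Urysohn function serves as
height and glues the lifts over any closed subset of `U ∪ V` (`LiftOn.nonempty_join`). The section
of the join sits at height 1/2, so this function must be 1/2 on the section of the source, which is
possible because that section is closed and contained in `U ∩ V`.

Induction on `n` finishes the proof. For the Ganea maps `u` is the identity. For the fat wedges `u`
is the diagonal, the pair of the identity and the shorter diagonal: lifting it through `f × id`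
means lifting the identity through `f`, and lifting it through `id × j_n` means lifting the shorter
diagonal through `j_n`. As gluing works over closed sets only, normality is used once more to shrink
the cover (`LiftCover.shrink`). -/

namespace unitInterval

/-- The affine map `s ↦ (1 - s) p + s q` of the unit interval, depending continuously on `p`, `q`. -/
noncomputable def seg : C(I × I, C(I, I)) :=
  ContinuousMap.curry ⟨fun q => ⟨(1 - (q.2 : ℝ)) * q.1.1 + q.2 * q.1.2, by
    obtain ⟨⟨⟨p, hp0, hp1⟩, ⟨r, hr0, hr1⟩⟩, ⟨t, ht0, ht1⟩⟩ := q
    constructor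
    · have := mul_nonneg (sub_nonneg.2 ht1) hp0
      have := mul_nonneg ht0 hr0
      simp only
      linarith
    · simp only
      nlinarith [mul_nonneg (sub_nonneg.2 ht1) (sub_nonneg.2 hp1),
        mul_nonneg ht0 (sub_nonneg.2 hr1)]⟩, by fun_prop⟩

theorem coe_seg (p q s : I) : (seg (p, q) s : ℝ) = (1 - (s : ℝ)) * p + s * q := rfl

@[simp] theorem seg_zero (p q : I) : seg (p, q) 0 = p := Subtype.ext (by simp [coe_seg])

@[simp] theorem seg_one (p q : I) : seg (p, q) 1 = q := Subtype.ext (by simp [coe_seg])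

/-- The midpoint of the unit interval. -/
noncomputable def mid : I := ⟨1 / 2, by norm_num, by norm_num⟩

theorem coe_mid : (mid : ℝ) = 1 / 2 := rfl

end unitInterval

/-! ### Concatenation of paths -/

namespace ContinuousMap

variable {K : Type*} [TopologicalSpace K]

/-- The concatenation of the paths `a` and `b` (which is `a` if they do not match). -/
noncomputable def concatPath (a b : C(I, K)) : C(I, K) :=
  open Classical in
  if h : a 1 = b 0 then
    ⟨fun t => if (t : ℝ) ≤ 1 / 2 then a (Set.projIcc 0 1 zero_le_one (2 * (t : ℝ)))
      else b (Set.projIcc 0 1 zero_le_one (2 * (t : ℝ) - 1)), by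
      refine Continuous.if_le ?_ ?_ (by fun_prop) (by fun_prop) ?_
      · exact a.continuous.comp (continuous_projIcc.comp (by fun_prop))
      · exact b.continuous.comp (continuous_projIcc.comp (by fun_prop))
      · intro t ht
        rw [ht]
        norm_num [h]⟩
  else a

theorem concatPath_apply {a b : C(I, K)} (h : a 1 = b 0) (t : I) :
    concatPath a b t = if (t : ℝ) ≤ 1 / 2 then a (Set.projIcc 0 1 zero_le_one (2 * (t : ℝ)))
      else b (Set.projIcc 0 1 zero_le_one (2 * (t : ℝ) - 1)) := by
  simp only [concatPath, dif_pos h, coe_mk]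

/-- Every value of the concatenation is a value of one of the two pieces. This settles compatibility
with projections and stationarity along sections without computing. -/
theorem concatPath_cases {a b : C(I, K)} (h : a 1 = b 0) {P : K → Prop} (ha : ∀ t, P (a t))
    (hb : ∀ t, P (b t)) (t : I) : P (concatPath a b t) := by
  rw [concatPath_apply h]
  split_ifs
  exacts [ha _, hb _]

theorem concatPath_zero {a b : C(I, K)} (h : a 1 = b 0) : concatPath a b 0 = a 0 := by
  rw [concatPath_apply h]
  simp

theorem concatPath_one {a b : C(I, K)} (h : a 1 = b 0) : concatPath a b 1 = b 1 := by
  rw [concatPath_apply h, if_neg (by norm_num)]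
  norm_num

/-- With `a` a reversed homotopy, running from the midpoint to 0 recovers the original homotopy.
This makes the formulas in `joinLift` agree where they meet. -/
theorem concatPath_seg_mid_zero {a b : C(I, K)} (h : a 1 = b 0) (s : I) :
    concatPath a b (seg (mid, 0) s) = a (unitInterval.symm s) := by
  have hs := s.2.1
  have e : ((seg (mid, 0) s : I) : ℝ) = (1 - s) / 2 := by
    rw [coe_seg, coe_mid]; simp; ring
  rw [concatPath_apply h, e, if_pos (by linarith)]
  congr 1
  rw [show 2 * ((1 - (s : ℝ)) / 2) = (unitInterval.symm s : ℝ) by simp; ring,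
    Set.projIcc_val]

theorem concatPath_seg_mid_one {a b : C(I, K)} (h : a 1 = b 0) (s : I) :
    concatPath a b (seg (mid, 1) s) = b s := by
  have hs := s.2.1
  have e : ((seg (mid, 1) s : I) : ℝ) = (1 + s) / 2 := by
    rw [coe_seg, coe_mid]; simp; ring
  rw [concatPath_apply h, e]
  split_ifs with h'
  · have : s = 0 := Subtype.ext (le_antisymm (by norm_num; linarith) hs)
    subst this
    norm_num [h]
  · congr 1
    rw [show 2 * ((1 + (s : ℝ)) / 2) - 1 = s by ring, Set.projIcc_val]

theorem concatPath_mid {a b : C(I, K)} (h : a 1 = b 0) : concatPath a b mid = a 1 := by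
  have := concatPath_seg_mid_zero h 0
  simpa using this

/-- Continuity into the compact-open topology is checked after uncurrying, where it is a pasting
along `t = 1/2`. The paths need to match only over `s`. -/
theorem continuousOn_concatPath {A : Type*} [TopologicalSpace A] {a b : A → C(I, K)} {s : Set A}
    (ha : ContinuousOn a s) (hb : ContinuousOn b s) (h : ∀ x ∈ s, a x 1 = b x 0) :
    ContinuousOn (fun x => concatPath (a x) (b x)) s := by
  rw [continuousOn_iff_continuous_domRestrict] at *
  refine ContinuousMap.continuous_of_continuous_uncurry _ ?_
  have e : (Function.uncurry fun (x : s) (t : I) => concatPath (a x) (b x) t) = fun q =>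
      if (q.2 : ℝ) ≤ 1 / 2 then a q.1 (Set.projIcc 0 1 zero_le_one (2 * (q.2 : ℝ)))
      else b q.1 (Set.projIcc 0 1 zero_le_one (2 * (q.2 : ℝ) - 1)) := by
    funext q
    exact concatPath_apply (h q.1.1 q.1.2) q.2
  change Continuous (Function.uncurry fun (x : s) (t : I) => concatPath (a x) (b x) t)
  rw [e]
  refine Continuous.if_le ?_ ?_ (by fun_prop) (by fun_prop) ?_
  · exact continuous_eval.comp ((ha.comp continuous_fst).prodMk
      ((continuous_projIcc (h := zero_le_one)).comp (by fun_prop)))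
  · exact continuous_eval.comp ((hb.comp continuous_fst).prodMk
      ((continuous_projIcc (h := zero_le_one)).comp (by fun_prop)))
  · intro q hq
    rw [hq]
    norm_num [h q.1.1 q.1.2]

end ContinuousMap

/-- A function separating two disjoint closed sets that is `1 / 2` on a third one. -/
theorem exists_continuous_zero_half_one_of_isClosed {X : Type*} [TopologicalSpace X]
    [NormalSpace X] {s t r : Set X} (hs : IsClosed s) (ht : IsClosed t) (hr : IsClosed r)
    (hst : Disjoint s t) (hsr : Disjoint s r) (htr : Disjoint t r) :
    ∃ l : C(X, ℝ), Set.EqOn l 0 s ∧ Set.EqOn l 1 t ∧ Set.EqOn l (fun _ => 1 / 2) r := by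
  -- The average of a function that is 1 on `t ∪ r` and one that is 0 on `s ∪ r` takes the value 1/2
  -- on `r`.
  obtain ⟨f, f0, f1, -⟩ := exists_continuous_zero_one_of_isClosed hs (ht.union hr)
    (hst.union_right hsr)
  obtain ⟨g, g0, g1, -⟩ := exists_continuous_zero_one_of_isClosed (hs.union hr) ht
    (hst.union_left htr.symm)
  refine ⟨⟨fun x => (f x + g x) / 2, by fun_prop⟩, fun x hx => ?_, fun x hx => ?_,
    fun x hx => ?_⟩
  · simp [f0 hx, g0 (Or.inl hx)]
  · simp [f1 (Or.inl hx), g1 hx]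
  · simp [f1 (Or.inr hx), g0 (Or.inr hx)]

/-! ### Homotopy lifts over a subset -/

namespace PtdFibMap

variable {B : Type u} [TopologicalSpace B]

/-- A lift of `u` through `h` over the set `U`, up to fibrewise pointed homotopy. The homotopy is
given as a family of paths `G x` from `u x` to `h (s x)`. -/
structure LiftOn {A Y K : PtdFibSpace B} (u : PtdFibMap A K) (h : PtdFibMap Y K)
    (U : Set A.carrier) where
  s : A.carrier → Y.carrier
  G : A.carrier → C(I, K.carrier)
  continuousOn_s : ContinuousOn s U
  continuousOn_G : ContinuousOn G U
  proj_G : ∀ x ∈ U, ∀ t, K.proj (G x t) = A.proj x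
  G_zero : ∀ x ∈ U, G x 0 = u.toMap x
  G_one : ∀ x ∈ U, G x 1 = h.toMap (s x)
  -- Required even for base points outside `U`. Values off `U` are arbitrary, so this costs nothing
  -- and avoids membership hypotheses.
  s_sec : ∀ b, s (A.sec b) = Y.sec b
  G_sec : ∀ b t, G (A.sec b) t = K.sec b

namespace LiftOn

variable {A Y Z K : PtdFibSpace B} {u : PtdFibMap A K} {h : PtdFibMap Y K} {k : PtdFibMap Z K}
  {U V : Set A.carrier}

theorem proj_s (l : LiftOn u h U) {x : A.carrier} (hx : x ∈ U) : Y.proj (l.s x) = A.proj x := by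
  rw [← h.proj_map, ← l.G_one x hx, l.proj_G x hx]

/-- Restriction to a smaller set. -/
def mono (l : LiftOn u h U) (hV : V ⊆ U) : LiftOn u h V where
  s := l.s
  G := l.G
  continuousOn_s := l.continuousOn_s.mono hV
  continuousOn_G := l.continuousOn_G.mono hV
  proj_G x hx := l.proj_G x (hV hx)
  G_zero x hx := l.G_zero x (hV hx)
  G_one x hx := l.G_one x (hV hx)
  s_sec := l.s_sec
  G_sec := l.G_sec

/-- The path `h (s x) → u x → k (s' x)` obtained from two lifts. -/
noncomputable def link (l : LiftOn u h U) (m : LiftOn u k V) (x : A.carrier) : C(I, K.carrier) :=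
  ((l.G x).comp ⟨unitInterval.symm, by fun_prop⟩).concatPath (m.G x)

section link

variable (l : LiftOn u h U) (m : LiftOn u k V) {x : A.carrier}

theorem link_match (hx : x ∈ U) (hx' : x ∈ V) :
    (l.G x).comp ⟨unitInterval.symm, by fun_prop⟩ 1 = m.G x 0 := by
  simp [l.G_zero x hx, m.G_zero x hx']

theorem link_zero (hx : x ∈ U) (hx' : x ∈ V) : link l m x 0 = h.toMap (l.s x) := by
  simp [link, ContinuousMap.concatPath_zero (link_match l m hx hx'), l.G_one x hx]

theorem link_one (hx : x ∈ U) (hx' : x ∈ V) : link l m x 1 = k.toMap (m.s x) := by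
  simp [link, ContinuousMap.concatPath_one (link_match l m hx hx'), m.G_one x hx']

theorem link_mid (hx : x ∈ U) (hx' : x ∈ V) : link l m x mid = u.toMap x := by
  simp [link, ContinuousMap.concatPath_mid (link_match l m hx hx'), l.G_zero x hx]

theorem proj_link (hx : x ∈ U) (hx' : x ∈ V) (t : I) : K.proj (link l m x t) = A.proj x :=
  ContinuousMap.concatPath_cases (P := fun y => K.proj y = A.proj x) (link_match l m hx hx')
    (fun _ => l.proj_G x hx _) (fun _ => m.proj_G x hx' _) t

theorem link_sec (b : B) (t : I) : link l m (A.sec b) t = K.sec b := by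
  unfold link
  exact ContinuousMap.concatPath_cases (P := fun y => y = K.sec b)
    (a := (l.G (A.sec b)).comp ⟨unitInterval.symm, by fun_prop⟩) (by simp [l.G_sec, m.G_sec])
    (fun _ => l.G_sec b _) (fun _ => m.G_sec b _) t

theorem continuousOn_link : ContinuousOn (link l m) (U ∩ V) :=
  ContinuousMap.continuousOn_concatPath
    ((ContinuousMap.continuous_precomp _).comp_continuousOn
      (l.continuousOn_G.mono Set.inter_subset_left))
    (m.continuousOn_G.mono Set.inter_subset_right) fun _ hx => link_match l m hx.1 hx.2

/-- The point of the homotopy pullback given by two lifts. -/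
noncomputable def pullbackPoint (x : A.carrier) (hx : x ∈ U) (hx' : x ∈ V) :
    (hpullback h k).carrier :=
  (⟨(l.s x, ⟨(A.proj x, link l m x), proj_link l m hx hx'⟩, m.s x),
    (link_zero l m hx hx').symm, (link_one l m hx hx').symm⟩ : HPullbackCarrier h k)

theorem continuous_pullbackPoint :
    Continuous fun x : (U ∩ V : Set A.carrier) => pullbackPoint l m x.1 x.2.1 x.2.2 := by
  have hs := continuousOn_iff_continuous_domRestrict.1
    (l.continuousOn_s.mono (Set.inter_subset_left (t := V)))
  have hs' := continuousOn_iff_continuous_domRestrict.1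
    (m.continuousOn_s.mono (Set.inter_subset_right (s := U)))
  have hl := continuousOn_iff_continuous_domRestrict.1 (continuousOn_link l m)
  refine Continuous.subtype_mk (hs.prodMk (Continuous.prodMk (Continuous.subtype_mk
    (Continuous.prodMk ?_ hl) _) hs')) _
  exact A.proj.continuous.comp continuous_subtype_val

theorem pullbackPoint_sec (b : B) (hx : A.sec b ∈ U) (hx' : A.sec b ∈ V) :
    pullbackPoint l m (A.sec b) hx hx' = (hpullback h k).sec b := by
  refine Subtype.ext (Prod.ext (l.s_sec b) (Prod.ext (Subtype.ext (Prod.ext (A.proj_sec b) ?_))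
    (m.s_sec b)))
  ext t
  exact link_sec l m b t

end link

end LiftOn

/-! ### Gluing two lifts into a lift through the join -/

namespace LiftOn

variable {A Y Z K : PtdFibSpace B} {u : PtdFibMap A K} {h : PtdFibMap Y K} {k : PtdFibMap Z K}
  {U V C : Set A.carrier}

section joinLift

variable (l : LiftOn u h U) (m : LiftOn u k V)

open Classical in
/-- The point of the cylinder part of the join at height `t` given by two lifts. -/
noncomputable def joinPoint (x : A.carrier) (t : I) : (join h k).carrier :=
  if hx : x ∈ U ∩ V then Quot.mk _ (.inr (.inl (pullbackPoint l m x hx.1 hx.2, t)))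
  -- Junk value: off `U ∩ V` there is no linking path.
  else (join h k).sec (A.proj x)

theorem joinPoint_of_mem {x : A.carrier} (hx : x ∈ U ∩ V) (t : I) :
    joinPoint l m x t = Quot.mk _ (.inr (.inl (pullbackPoint l m x hx.1 hx.2, t))) :=
  dif_pos hx

theorem continuousOn_joinPoint {t : A.carrier → I} (ht : Continuous t) :
    ContinuousOn (fun x => joinPoint l m x (t x)) (U ∩ V) := by
  rw [continuousOn_iff_continuous_domRestrict]
  have e : (U ∩ V).domRestrict (fun x => joinPoint l m x (t x)) = fun x : (U ∩ V : Set A.carrier) =>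
      Quot.mk _ (.inr (.inl (pullbackPoint l m x.1 x.2.1 x.2.2, t x))) := by
    funext x
    exact joinPoint_of_mem l m x.2 _
  rw [e]
  exact continuous_quot_mk.comp (continuous_inr.comp (continuous_inl.comp
    ((continuous_pullbackPoint l m).prodMk (ht.comp continuous_subtype_val))))

theorem joinPoint_zero {x : A.carrier} (hx : x ∈ U ∩ V) :
    joinPoint l m x 0 = Quot.mk _ (.inl (l.s x)) :=
  (joinPoint_of_mem l m hx _).trans (Quot.sound (HPushoutRel.left (f := hpullbackFst h k)
    (g := hpullbackSnd h k) (pullbackPoint l m x hx.1 hx.2)))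

theorem joinPoint_one {x : A.carrier} (hx : x ∈ U ∩ V) :
    joinPoint l m x 1 = Quot.mk _ (.inr (.inr (m.s x))) :=
  (joinPoint_of_mem l m hx _).trans (Quot.sound (HPushoutRel.right (f := hpullbackFst h k)
    (g := hpullbackSnd h k) (pullbackPoint l m x hx.1 hx.2)))

theorem joinMap_joinPoint {x : A.carrier} (hx : x ∈ U ∩ V) (t : I) :
    (joinMap h k).toMap (joinPoint l m x t) = link l m x t := by
  rw [joinPoint_of_mem l m hx]
  rfl

theorem joinPoint_sec {b : B} (hb : A.sec b ∈ U ∩ V) :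
    joinPoint l m (A.sec b) mid = (join h k).sec b := by
  rw [joinPoint_of_mem l m hb, pullbackPoint_sec]
  rfl

/-- The height in the join assigned to the value `r` of a separating function. -/
noncomputable def height (r : ℝ) : I := Set.projIcc 0 1 zero_le_one (2 * r - 1 / 2)

theorem continuous_height : Continuous height :=
  continuous_projIcc.comp (by fun_prop)

/-- The affine map `2 r - 1/2` takes [1/4, 3/4] onto [0, 1] and fixes 1/2. Beyond that interval the
height is constant, which leaves closed collars where only one of the lifts is used. -/
theorem height_of_le {r : ℝ} (hr : r ≤ 1 / 4) : height r = 0 :=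
  Set.projIcc_of_le_left _ (by linarith)

theorem height_of_ge {r : ℝ} (hr : 3 / 4 ≤ r) : height r = 1 :=
  Set.projIcc_of_right_le _ (by linarith)

theorem height_half : height (1 / 2) = mid := by
  refine Subtype.ext ?_
  rw [height, Set.projIcc_of_mem _ (by norm_num), coe_mid]
  norm_num

/-- Two lifts of `u`, through `h` and through `k`, and a separating function, yield a lift
through the join of `h` and `k`. -/
noncomputable def joinLift (r : C(A.carrier, ℝ)) (hC : IsClosed C)
    (hU : ∀ x ∈ C, r x < 1 → x ∈ U) (hV : ∀ x ∈ C, 0 < r x → x ∈ V)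
    (hr : ∀ b, r (A.sec b) = 1 / 2) (hsec : ∀ b, A.sec b ∈ C) :
    LiftOn u (joinMap h k) C := by
  -- Point and homotopy are built together. In the middle zone the homotopy runs along the link from
  -- its midpoint, which is `u x`, to the chosen height, which is the image of the chosen point of
  -- the join.
  let P : A.carrier → (join h k).carrier × C(I, K.carrier) := fun x =>
    if r x ≤ 1 / 4 then (Quot.mk _ (.inl (l.s x)), l.G x)
    else if 3 / 4 ≤ r x then (Quot.mk _ (.inr (.inr (m.s x))), m.G x)
    else (joinPoint l m x (height (r x)), (link l m x).comp (seg (mid, height (r x))))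
  have hUV : ∀ x ∈ C, 1 / 4 ≤ r x → r x ≤ 3 / 4 → x ∈ U ∩ V := fun x hx h1 h2 =>
    ⟨hU x hx (by linarith), hV x hx (by linarith)⟩
  have P_left : ∀ x, r x ≤ 1 / 4 → P x = (Quot.mk _ (.inl (l.s x)), l.G x) := fun x hx =>
    if_pos hx
  have P_right : ∀ x, 3 / 4 ≤ r x → P x = (Quot.mk _ (.inr (.inr (m.s x))), m.G x) :=
    fun x hx => (if_neg (by linarith)).trans (if_pos hx)
  have P_mid : ∀ x ∈ C, 1 / 4 ≤ r x → r x ≤ 3 / 4 → P x =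
      (joinPoint l m x (height (r x)), (link l m x).comp (seg (mid, height (r x)))) := by
    intro x hx h1 h2
    have hx' := hUV x hx h1 h2
    -- At the two borders the formulas agree: the join identifies the ends of the cylinder with `Y`
    -- and `Z`, and half of the link is the homotopy of one lift.
    rcases h1.eq_or_lt with h1 | h1
    · rw [P_left x h1.ge, height_of_le h1.ge, joinPoint_zero l m hx']
      refine Prod.ext rfl (ContinuousMap.ext fun s => ?_)
      simp [link, ContinuousMap.concatPath_seg_mid_zero (link_match l m hx'.1 hx'.2)]
    rcases h2.eq_or_lt with h2 | h2
    · rw [P_right x h2.ge, height_of_ge h2.ge, joinPoint_one l m hx']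
      refine Prod.ext rfl (ContinuousMap.ext fun s => ?_)
      simp [link, ContinuousMap.concatPath_seg_mid_one (link_match l m hx'.1 hx'.2)]
    · exact (if_neg (by linarith)).trans (if_neg (by linarith))
  -- Pasting over three relatively closed pieces of `C`.
  have cP : ContinuousOn P C := by
    have c1 : ContinuousOn P (C ∩ {x | r x ≤ 1 / 4}) := by
      have hs : C ∩ {x | r x ≤ 1 / 4} ⊆ U := fun x hx =>
        hU x hx.1 (lt_of_le_of_lt hx.2 (by norm_num))
      refine ContinuousOn.congr (ContinuousOn.prodMk ?_ (l.continuousOn_G.mono hs))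
        fun x hx => P_left x hx.2
      exact (continuous_quot_mk.comp continuous_inl).comp_continuousOn (l.continuousOn_s.mono hs)
    have c2 : ContinuousOn P (C ∩ {x | 3 / 4 ≤ r x}) := by
      have hs : C ∩ {x | 3 / 4 ≤ r x} ⊆ V := fun x hx =>
        hV x hx.1 (lt_of_lt_of_le (by norm_num) hx.2)
      refine ContinuousOn.congr (ContinuousOn.prodMk ?_ (m.continuousOn_G.mono hs))
        fun x hx => P_right x hx.2
      exact (continuous_quot_mk.comp (continuous_inr.comp continuous_inr)).comp_continuousOn
        (m.continuousOn_s.mono hs)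
    have c3 : ContinuousOn P (C ∩ {x | 1 / 4 ≤ r x ∧ r x ≤ 3 / 4}) := by
      have hs : C ∩ {x | 1 / 4 ≤ r x ∧ r x ≤ 3 / 4} ⊆ U ∩ V := fun x hx =>
        hUV x hx.1 hx.2.1 hx.2.2
      have hh : Continuous fun x => height (r x) := continuous_height.comp r.continuous
      refine ContinuousOn.congr (ContinuousOn.prodMk ((continuousOn_joinPoint l m hh).mono hs)
        (((continuousOn_link l m).mono hs).compCM (Continuous.continuousOn ?_)))
        fun x hx => P_mid x hx.1 hx.2.1 hx.2.2
      exact seg.continuous.comp (continuous_const.prodMk hh)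
    have hc1 : IsClosed (C ∩ {x | r x ≤ 1 / 4}) :=
      hC.inter (isClosed_le r.continuous continuous_const)
    have hc2 : IsClosed (C ∩ {x | 3 / 4 ≤ r x}) :=
      hC.inter (isClosed_le continuous_const r.continuous)
    have hc3 : IsClosed (C ∩ {x | 1 / 4 ≤ r x ∧ r x ≤ 3 / 4}) :=
      hC.inter ((isClosed_le continuous_const r.continuous).inter
        (isClosed_le r.continuous continuous_const))
    refine ((c1.union_of_isClosed c2 hc1 hc2).union_of_isClosed c3 (hc1.union hc2) hc3).mono ?_
    intro x hx
    by_cases h1 : r x ≤ 1 / 4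
    · exact Or.inl (Or.inl ⟨hx, h1⟩)
    by_cases h2 : 3 / 4 ≤ r x
    · exact Or.inl (Or.inr ⟨hx, h2⟩)
    · exact Or.inr ⟨hx, (not_le.1 h1).le, (not_le.1 h2).le⟩
  have cases : ∀ x ∈ C, (x ∈ U ∧ P x = (Quot.mk _ (.inl (l.s x)), l.G x)) ∨
      (x ∈ V ∧ P x = (Quot.mk _ (.inr (.inr (m.s x))), m.G x)) ∨
      (x ∈ U ∩ V ∧ P x =
        (joinPoint l m x (height (r x)), (link l m x).comp (seg (mid, height (r x))))) := by
    intro x hx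
    by_cases h1 : r x ≤ 1 / 4
    · exact Or.inl ⟨hU x hx (by linarith), P_left x h1⟩
    by_cases h2 : 3 / 4 ≤ r x
    · exact Or.inr (Or.inl ⟨hV x hx (by linarith), P_right x h2⟩)
    · have h1' := (not_le.1 h1).le
      have h2' := (not_le.1 h2).le
      exact Or.inr (Or.inr ⟨hUV x hx h1' h2', P_mid x hx h1' h2'⟩)
  have P_sec : ∀ b, P (A.sec b) = ((join h k).sec b, ContinuousMap.const I (K.sec b)) := by
    intro b
    have h1 : 1 / 4 ≤ r (A.sec b) := by rw [hr]; norm_num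
    have h2 : r (A.sec b) ≤ 3 / 4 := by rw [hr]; norm_num
    rw [P_mid _ (hsec b) h1 h2, hr, height_half, joinPoint_sec l m (hUV _ (hsec b) h1 h2)]
    refine Prod.ext rfl (ContinuousMap.ext fun s => ?_)
    exact link_sec l m b _
  exact
    { s := fun x => (P x).1
      G := fun x => (P x).2
      continuousOn_s := cP.fst
      continuousOn_G := cP.snd
      proj_G := by
        intro x hx t
        rcases cases x hx with ⟨hx', e⟩ | ⟨hx', e⟩ | ⟨hx', e⟩ <;> rw [e]
        · exact l.proj_G x hx' t
        · exact m.proj_G x hx' t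
        · exact proj_link l m hx'.1 hx'.2 _
      G_zero := by
        intro x hx
        rcases cases x hx with ⟨hx', e⟩ | ⟨hx', e⟩ | ⟨hx', e⟩ <;> rw [e]
        · exact l.G_zero x hx'
        · exact m.G_zero x hx'
        · simp [link_mid l m hx'.1 hx'.2]
      G_one := by
        intro x hx
        rcases cases x hx with ⟨hx', e⟩ | ⟨hx', e⟩ | ⟨hx', e⟩ <;> rw [e]
        · exact l.G_one x hx'
        · exact m.G_one x hx'
        · simp [joinMap_joinPoint l m hx']
      s_sec := fun b => by rw [P_sec]
      G_sec := fun b t => by rw [P_sec]; rfl }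

end joinLift

/-- In a normal space with closed section, lifts of `u` through `h` over an open set `U` and through
`k` over an open set `V` yield a lift through the join over any closed subset of `U ∪ V`. -/
theorem nonempty_join [NormalSpace A.carrier] (hA : IsClosed (Set.range A.sec))
    (l : LiftOn u h U) (m : LiftOn u k V) (hU : IsOpen U) (hV : IsOpen V) (hC : IsClosed C)
    (hsU : ∀ b, A.sec b ∈ U) (hsV : ∀ b, A.sec b ∈ V) (hsC : ∀ b, A.sec b ∈ C)
    (hUV : C ⊆ U ∪ V) : Nonempty (LiftOn u (joinMap h k) C) := by
  -- The function is 0 where only the lift over `U` exists and 1 where only the lift over `V`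
  -- exists, so `r x < 1` forces `x ∈ U` and `0 < r x` forces `x ∈ V`.
  obtain ⟨r, r0, r1, rh⟩ := exists_continuous_zero_half_one_of_isClosed
    (s := C ∩ Vᶜ) (t := C ∩ Uᶜ) (hC.inter hV.isClosed_compl) (hC.inter hU.isClosed_compl) hA
    (Set.disjoint_left.2 fun x hx hx' => (hUV hx.1).elim hx'.2 hx.2)
    (Set.disjoint_left.2 fun x hx ⟨b, hb⟩ => hx.2 (hb ▸ hsV b))
    (Set.disjoint_left.2 fun x hx ⟨b, hb⟩ => hx.2 (hb ▸ hsU b))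
  refine ⟨joinLift l m r hC (fun x hx h1 => ?_) (fun x hx h0 => ?_) (fun b => rh ⟨b, rfl⟩) hsC⟩
  · by_contra hxU
    exact h1.ne (r1 ⟨hx, hxU⟩)
  · by_contra hxV
    exact h0.ne' (r0 ⟨hx, hxV⟩)

end LiftOn

/-! ### Composition of lifts -/

namespace LiftOn

variable {A Y Z K M : PtdFibSpace B} {u : PtdFibMap A K} {h : PtdFibMap Y K} {k : PtdFibMap Z K}
  {U V : Set A.carrier}

/-- A lift of `u` through `k` followed by a lift of `k` through `h`. -/
noncomputable def trans (l : LiftOn u k U) {N : Set Z.carrier} (m : LiftOn k h N) :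
    LiftOn u h (U ∩ l.s ⁻¹' N) where
  s x := m.s (l.s x)
  G x := (l.G x).concatPath (m.G (l.s x))
  continuousOn_s := m.continuousOn_s.comp (l.continuousOn_s.mono Set.inter_subset_left)
    fun _ hx => hx.2
  continuousOn_G := ContinuousMap.continuousOn_concatPath
    (l.continuousOn_G.mono Set.inter_subset_left)
    (m.continuousOn_G.comp (l.continuousOn_s.mono Set.inter_subset_left) fun _ hx => hx.2)
    fun x hx => (l.G_one x hx.1).trans (m.G_zero _ hx.2).symm
  proj_G x hx t := ContinuousMap.concatPath_cases (P := fun y => K.proj y = A.proj x)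
    ((l.G_one x hx.1).trans (m.G_zero _ hx.2).symm) (fun _ => l.proj_G x hx.1 _)
    (fun _ => (m.proj_G _ hx.2 _).trans (l.proj_s hx.1)) t
  G_zero x hx := (ContinuousMap.concatPath_zero
    ((l.G_one x hx.1).trans (m.G_zero _ hx.2).symm)).trans (l.G_zero x hx.1)
  G_one x hx := (ContinuousMap.concatPath_one
    ((l.G_one x hx.1).trans (m.G_zero _ hx.2).symm)).trans (m.G_one _ hx.2)
  s_sec b := by rw [l.s_sec, m.s_sec]
  G_sec b t := by
    rw [l.s_sec]
    exact ContinuousMap.concatPath_cases (P := fun y => y = K.sec b) (by rw [l.G_sec, m.G_sec])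
      (fun _ => l.G_sec b _) (fun _ => m.G_sec b _) t

/-- The stationary lift through the identity. -/
def refl (u : PtdFibMap A K) (U : Set A.carrier) : LiftOn u (id K) U where
  s := u.toMap
  G x := ContinuousMap.const I (u.toMap x)
  continuousOn_s := u.toMap.continuous.continuousOn
  continuousOn_G := (ContinuousMap.continuous_const'.comp u.toMap.continuous).continuousOn
  proj_G x _ _ := u.proj_map x
  G_zero _ _ := rfl
  G_one _ _ := rfl
  s_sec := u.map_sec
  G_sec b _ := u.map_sec b

/-- The projection of a homotopy pullback to the space of paths. -/
def pullbackPath (q : (hpullback h k).carrier) : C(I, K.carrier) := q.1.2.1.1.2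

theorem continuous_pullbackPath : Continuous (pullbackPath (h := h) (k := k)) :=
  continuous_snd.comp (continuous_subtype_val.comp (continuous_fst.comp
    (continuous_snd.comp continuous_subtype_val)))

/-! ### Deforming the two open halves of the join to its ends -/

section join

variable (h k)

/-- The height function of the join. -/
def joinHeight : C((join h k).carrier, I) where
  toFun := Quot.lift (Sum.elim (fun _ => 0) (Sum.elim (fun q => q.2) fun _ => 1)) (by
    rintro _ _ (x | x) <;> rfl)
  continuous_toFun := continuous_quot_lift _
    (continuous_const.sumElim (continuous_snd.sumElim continuous_const))

-- A quotient map restricted to the preimage of an open set is still a quotient map, and the three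
-- summands are open in the disjoint union.
variable {h k} in
theorem continuousOn_join {T : Type*} [TopologicalSpace T] {N : Set (join h k).carrier}
    (hN : IsOpen N) {g : (join h k).carrier → T}
    (hY : ∀ y, Quot.mk _ (.inl y) ∈ N → ContinuousAt (fun y => g (Quot.mk _ (.inl y))) y)
    (hL : ∀ q, Quot.mk _ (.inr (.inl q)) ∈ N →
      ContinuousAt (fun q => g (Quot.mk _ (.inr (.inl q)))) q)
    (hZ : ∀ z, Quot.mk _ (.inr (.inr z)) ∈ N →
      ContinuousAt (fun z => g (Quot.mk _ (.inr (.inr z)))) z) : ContinuousOn g N := by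
  refine (isQuotientMap_quot_mk.continuousOn_isOpen_iff hN).2 ?_
  refine fun x hx => ContinuousAt.continuousWithinAt ?_
  rcases x with y | q | z
  · exact Topology.IsOpenEmbedding.inl.continuousAt_iff.1 (hY y hx)
  · exact (Topology.IsOpenEmbedding.inr.comp Topology.IsOpenEmbedding.inl).continuousAt_iff.1
      (hL q hx)
  · exact (Topology.IsOpenEmbedding.inr.comp Topology.IsOpenEmbedding.inr).continuousAt_iff.1
      (hZ z hx)

/-- Away from its right end, the join retracts to its left end. -/
noncomputable def retractLeft : LiftOn (joinMap h k) h {q | joinHeight h k q < 1} := by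
  classical
  -- A point at height `t < 1` slides along its path from `t` back to 0. The excluded right end
  -- receives base points, also on the cylinder at `t = 1`, so that the function respects the
  -- gluing.
  let R : (join h k).carrier → Y.carrier × C(I, K.carrier) := Quot.lift
    (Sum.elim (fun y => (y, ContinuousMap.const I (h.toMap y)))
      (Sum.elim (fun q => if q.2 = 1 then
          (Y.sec ((hpullback h k).proj q.1), ContinuousMap.const I (K.sec ((hpullback h k).proj q.1)))
        else ((hpullbackFst h k).toMap q.1, (pullbackPath q.1).comp (seg (q.2, 0))))
      fun z => (Y.sec (Z.proj z), ContinuousMap.const I (K.sec (Z.proj z))))) (by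
    rintro _ _ (x | x)
    · refine (if_neg zero_ne_one).trans (Prod.ext rfl (ContinuousMap.ext fun s => ?_))
      have : seg (0, 0) s = 0 := Subtype.ext (by simp [coe_seg])
      simp only [ContinuousMap.comp_apply, this]
      exact x.2.1.symm
    · refine (if_pos rfl).trans ?_
      rw [← (hpullbackSnd h k).proj_map x]
      rfl)
  have R_cyl : ∀ q : (hpullback h k).carrier × I, q.2 < 1 → R (Quot.mk _ (.inr (.inl q))) =
      ((hpullbackFst h k).toMap q.1, (pullbackPath q.1).comp (seg (q.2, 0))) :=
    fun q hq => if_neg hq.ne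
  have hN : IsOpen {q | joinHeight h k q < 1} :=
    isOpen_lt (joinHeight h k).continuous continuous_const
  have cR : ContinuousOn R {q | joinHeight h k q < 1} := by
    refine continuousOn_join hN (fun y _ => Continuous.continuousAt ?_) (fun q hq => ?_)
      fun z hz => absurd hz (lt_irrefl (1 : I))
    · exact continuous_id.prodMk (ContinuousMap.continuous_const'.comp h.toMap.continuous)
    · have c : Continuous fun q : (hpullback h k).carrier × I =>
          ((hpullbackFst h k).toMap q.1, (pullbackPath q.1).comp (seg (q.2, 0))) :=
        ((hpullbackFst h k).toMap.continuous.comp continuous_fst).prodMk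
          ((continuous_pullbackPath.comp continuous_fst).compCM
            (seg.continuous.comp (continuous_snd.prodMk continuous_const)))
      refine c.continuousAt.congr ?_
      filter_upwards [(isOpen_lt continuous_snd continuous_const).mem_nhds hq] with q' hq'
      exact (R_cyl q' hq').symm
  exact
    { s := fun x => (R x).1
      G := fun x => (R x).2
      continuousOn_s := cR.fst
      continuousOn_G := cR.snd
      proj_G := by
        rintro ⟨y | q | z⟩ hx t
        · exact h.proj_map y
        · rw [R_cyl q hx]
          exact q.1.1.2.1.2 _
        · exact absurd hx (lt_irrefl (1 : I))
      G_zero := by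
        rintro ⟨y | q | z⟩ hx
        · rfl
        · rw [R_cyl q hx, ContinuousMap.comp_apply, seg_zero]
          rfl
        · exact absurd hx (lt_irrefl (1 : I))
      G_one := by
        rintro ⟨y | q | z⟩ hx
        · rfl
        · rw [R_cyl q hx, ContinuousMap.comp_apply, seg_one]
          exact q.1.2.1.symm
        · exact absurd hx (lt_irrefl (1 : I))
      s_sec := fun b => congrArg Prod.fst (R_cyl ((hpullback h k).sec b, mid)
        (Subtype.coe_lt_coe.1 (by rw [coe_mid]; norm_num)))
      G_sec := fun b t => congrArg (fun p => p.2 t) (R_cyl ((hpullback h k).sec b, mid)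
        (Subtype.coe_lt_coe.1 (by rw [coe_mid]; norm_num))) }

/-- Away from its left end, the join retracts to its right end. -/
noncomputable def retractRight : LiftOn (joinMap h k) k {q | 0 < joinHeight h k q} := by
  classical
  -- The mirror image: points slide from `t` to 1, and the left end receives base points.
  let R : (join h k).carrier → Z.carrier × C(I, K.carrier) := Quot.lift
    (Sum.elim (fun y => (Z.sec (Y.proj y), ContinuousMap.const I (K.sec (Y.proj y))))
      (Sum.elim (fun q => if q.2 = 0 then
          (Z.sec ((hpullback h k).proj q.1), ContinuousMap.const I (K.sec ((hpullback h k).proj q.1)))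
        else ((hpullbackSnd h k).toMap q.1, (pullbackPath q.1).comp (seg (q.2, 1))))
      fun z => (z, ContinuousMap.const I (k.toMap z)))) (by
    rintro _ _ (x | x)
    · refine (if_pos rfl).trans ?_
      rw [← (hpullbackFst h k).proj_map x]
      rfl
    · refine (if_neg one_ne_zero).trans (Prod.ext rfl (ContinuousMap.ext fun s => ?_))
      have : seg (1, 1) s = 1 := Subtype.ext (by simp [coe_seg])
      simp only [ContinuousMap.comp_apply, this]
      exact x.2.2.symm)
  have R_cyl : ∀ q : (hpullback h k).carrier × I, 0 < q.2 → R (Quot.mk _ (.inr (.inl q))) =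
      ((hpullbackSnd h k).toMap q.1, (pullbackPath q.1).comp (seg (q.2, 1))) :=
    fun q hq => if_neg hq.ne'
  have hN : IsOpen {q | 0 < joinHeight h k q} :=
    isOpen_lt continuous_const (joinHeight h k).continuous
  have cR : ContinuousOn R {q | 0 < joinHeight h k q} := by
    refine continuousOn_join hN (fun y hy => absurd hy (lt_irrefl (0 : I))) (fun q hq => ?_)
      fun z _ => Continuous.continuousAt ?_
    · have c : Continuous fun q : (hpullback h k).carrier × I =>
          ((hpullbackSnd h k).toMap q.1, (pullbackPath q.1).comp (seg (q.2, 1))) :=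
        ((hpullbackSnd h k).toMap.continuous.comp continuous_fst).prodMk
          ((continuous_pullbackPath.comp continuous_fst).compCM
            (seg.continuous.comp (continuous_snd.prodMk continuous_const)))
      refine c.continuousAt.congr ?_
      filter_upwards [(isOpen_lt continuous_const continuous_snd).mem_nhds hq] with q' hq'
      exact (R_cyl q' hq').symm
    · exact continuous_id.prodMk (ContinuousMap.continuous_const'.comp k.toMap.continuous)
  exact
    { s := fun x => (R x).1
      G := fun x => (R x).2
      continuousOn_s := cR.fst
      continuousOn_G := cR.snd
      proj_G := by
        rintro ⟨y | q | z⟩ hx t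
        · exact absurd hx (lt_irrefl (0 : I))
        · rw [R_cyl q hx]
          exact q.1.1.2.1.2 _
        · exact k.proj_map z
      G_zero := by
        rintro ⟨y | q | z⟩ hx
        · exact absurd hx (lt_irrefl (0 : I))
        · rw [R_cyl q hx, ContinuousMap.comp_apply, seg_zero]
          rfl
        · rfl
      G_one := by
        rintro ⟨y | q | z⟩ hx
        · exact absurd hx (lt_irrefl (0 : I))
        · rw [R_cyl q hx, ContinuousMap.comp_apply, seg_one]
          exact q.1.2.2.symm
        · rfl
      s_sec := fun b => congrArg Prod.fst (R_cyl ((hpullback h k).sec b, mid)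
        (Subtype.coe_lt_coe.1 (by rw [coe_mid]; norm_num)))
      G_sec := fun b t => congrArg (fun p => p.2 t) (R_cyl ((hpullback h k).sec b, mid)
        (Subtype.coe_lt_coe.1 (by rw [coe_mid]; norm_num))) }

end join

/-! ### Lifts through fibrewise products -/

section prod

variable {N : PtdFibSpace B} {v : PtdFibMap A M} {g : PtdFibMap N M}

/-- The product of two lifts. -/
noncomputable def prod (l : LiftOn u h U) (m : LiftOn v g U) :
    LiftOn (lift u v) (prodMap h g) U := by
  classical
  -- Off `U` the two components may lie over different points of `B`, so a base point replaces the
  -- pair.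
  let S : A.carrier → (Y.prod N).carrier := fun x =>
    if hx : x ∈ U then (⟨(l.s x, m.s x), (l.proj_s hx).trans (m.proj_s hx).symm⟩ :
      {q : Y.carrier × N.carrier // Y.proj q.1 = N.proj q.2})
    else (Y.prod N).sec (A.proj x)
  let F : A.carrier → I → (K.prod M).carrier := fun x t =>
    if hx : x ∈ U then (⟨(l.G x t, m.G x t), (l.proj_G x hx t).trans (m.proj_G x hx t).symm⟩ :
      {q : K.carrier × M.carrier // K.proj q.1 = M.proj q.2})
    else (K.prod M).sec (A.proj x)
  have S_val : ∀ x ∈ U, (S x).1 = (l.s x, m.s x) := fun x hx => congrArg Subtype.val (dif_pos hx)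
  have F_val : ∀ x ∈ U, ∀ t, (F x t).1 = (l.G x t, m.G x t) := fun x hx t =>
    congrArg Subtype.val (dif_pos hx)
  have S_sec : ∀ b, S (A.sec b) = (Y.prod N).sec b := fun b => by
    by_cases hb : A.sec b ∈ U
    · exact Subtype.ext ((S_val _ hb).trans (Prod.ext (l.s_sec b) (m.s_sec b)))
    · exact (dif_neg hb).trans (congrArg _ (A.proj_sec b))
  have F_sec : ∀ b t, F (A.sec b) t = (K.prod M).sec b := fun b t => by
    by_cases hb : A.sec b ∈ U
    · exact Subtype.ext ((F_val _ hb t).trans (Prod.ext (l.G_sec b t) (m.G_sec b t)))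
    · exact (dif_neg hb).trans (congrArg _ (A.proj_sec b))
  have F_cont : ∀ x, Continuous (F x) := fun x => by
    by_cases hx : x ∈ U
    · refine Topology.IsInducing.subtypeVal.continuous_iff.2 ?_
      exact Continuous.congr (f := fun t => (l.G x t, m.G x t)) (by fun_prop)
        fun t => (F_val x hx t).symm
    · have : F x = fun _ => (K.prod M).sec (A.proj x) := funext fun t => dif_neg hx
      rw [this]
      exact continuous_const
  exact
    { s := S
      G := fun x => ⟨F x, F_cont x⟩
      continuousOn_s := by
        refine Topology.IsInducing.subtypeVal.continuousOn_iff.2 ?_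
        exact (l.continuousOn_s.prodMk m.continuousOn_s).congr S_val
      continuousOn_G := by
        rw [continuousOn_iff_continuous_domRestrict]
        refine ContinuousMap.continuous_of_continuous_uncurry _ ?_
        refine Topology.IsInducing.subtypeVal.continuous_iff.2 ?_
        have hl := continuousOn_iff_continuous_domRestrict.1 l.continuousOn_G
        have hm := continuousOn_iff_continuous_domRestrict.1 m.continuousOn_G
        refine Continuous.congr (f := fun q : U × I => (l.G q.1 q.2, m.G q.1 q.2)) ?_
          fun q => (F_val q.1 q.1.2 q.2).symm
        exact (continuous_eval.comp ((hl.comp continuous_fst).prodMk continuous_snd)).prodMk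
          (continuous_eval.comp ((hm.comp continuous_fst).prodMk continuous_snd))
      proj_G := fun x hx t =>
        (congrArg (fun p => K.proj p.1) (F_val x hx t)).trans (l.proj_G x hx t)
      G_zero := fun x hx =>
        Subtype.ext ((F_val x hx 0).trans (Prod.ext (l.G_zero x hx) (m.G_zero x hx)))
      G_one := fun x hx => Subtype.ext ((F_val x hx 1).trans
        ((Prod.ext (l.G_one x hx) (m.G_one x hx)).trans
          (congrArg (fun p => (h.toMap p.1, g.toMap p.2)) (S_val x hx).symm)))
      s_sec := S_sec
      G_sec := F_sec }

/-- The first component of a lift through a product. -/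
def fst (l : LiftOn (lift u v) (prodMap h g) U) : LiftOn u h U where
  s x := (l.s x).1.1
  G x := ContinuousMap.comp ⟨fun q : (K.prod M).carrier => q.1.1,
    continuous_fst.comp continuous_subtype_val⟩ (l.G x)
  continuousOn_s := (continuous_fst.comp continuous_subtype_val).comp_continuousOn
    l.continuousOn_s
  continuousOn_G := (ContinuousMap.continuous_postcomp _).comp_continuousOn l.continuousOn_G
  proj_G x hx t := l.proj_G x hx t
  G_zero x hx := congrArg (fun q => q.1.1) (l.G_zero x hx)
  G_one x hx := congrArg (fun q => q.1.1) (l.G_one x hx)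
  s_sec b := congrArg (fun q => q.1.1) (l.s_sec b)
  G_sec b t := congrArg (fun q => q.1.1) (l.G_sec b t)

/-- The second component of a lift through a product. -/
def snd (l : LiftOn (lift u v) (prodMap h g) U) : LiftOn v g U where
  s x := (l.s x).1.2
  G x := ContinuousMap.comp ⟨fun q : (K.prod M).carrier => q.1.2,
    continuous_snd.comp continuous_subtype_val⟩ (l.G x)
  continuousOn_s := (continuous_snd.comp continuous_subtype_val).comp_continuousOn
    l.continuousOn_s
  continuousOn_G := (ContinuousMap.continuous_postcomp _).comp_continuousOn l.continuousOn_G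
  proj_G x hx t := (l.G x t).2.symm.trans (l.proj_G x hx t)
  G_zero x hx := congrArg (fun q => q.1.2) (l.G_zero x hx)
  G_one x hx := congrArg (fun q => q.1.2) (l.G_one x hx)
  s_sec b := congrArg (fun q => q.1.2) (l.s_sec b)
  G_sec b t := congrArg (fun q => q.1.2) (l.G_sec b t)

end prod

end LiftOn

/-! ### Translation from maps and homotopies to lifts -/

theorem Homotopic.symm {X Y : PtdFibSpace B} {f g : PtdFibMap X Y} (H : f.Homotopic g) :
    g.Homotopic f := by
  obtain ⟨H, hp, h0, h1⟩ := H
  refine ⟨⟨H.toMap.comp ⟨fun q : X.carrier × I => (q.1, unitInterval.symm q.2), by fun_prop⟩,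
    fun x => H.proj_map (x.1, unitInterval.symm x.2)⟩, fun b t => hp b _, fun x => ?_, fun x => ?_⟩
  · change H.toMap (x, unitInterval.symm 0) = _
    rw [unitInterval.symm_zero, h1]
  · change H.toMap (x, unitInterval.symm 1) = _
    rw [unitInterval.symm_one, h0]

/-- Lifts over the whole space are fibrewise pointed homotopy factorizations. -/
theorem nonempty_liftOn_univ_iff {A Y K : PtdFibSpace B} {u : PtdFibMap A K}
    {h : PtdFibMap Y K} :
    Nonempty (LiftOn u h Set.univ) ↔ ∃ φ : PtdFibMap A Y, u.Homotopic (h.comp φ) := by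
  constructor
  · rintro ⟨l⟩
    have hs := continuousOn_univ.1 l.continuousOn_s
    have hG := continuousOn_univ.1 l.continuousOn_G
    refine ⟨⟨⟨⟨l.s, hs⟩, fun x => l.proj_s trivial⟩, l.s_sec⟩,
      ⟨(⟨fun q : A.carrier × I => l.G q.1 q.2, ?_⟩ : C(A.carrier × I, K.carrier)),
        fun q => l.proj_G q.1 trivial q.2⟩, l.G_sec,
      fun x => l.G_zero x trivial, fun x => l.G_one x trivial⟩
    exact continuous_eval.comp ((hG.comp continuous_fst).prodMk continuous_snd)
  · rintro ⟨φ, H, hp, h0, h1⟩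
    exact ⟨
      { s := φ.toMap
        G := ContinuousMap.curry (X := A.carrier) (Y := I) H.toMap
        continuousOn_s := φ.toMap.continuous.continuousOn
        continuousOn_G := (ContinuousMap.curry (X := A.carrier) (Y := I)
          H.toMap).continuous.continuousOn
        proj_G := fun x _ t => H.proj_map (x, t)
        G_zero := fun x _ => h0 x
        G_one := fun x _ => h1 x
        s_sec := φ.map_sec
        G_sec := hp }⟩

/-- `U` is an open set that contains the section and over which `u` lifts through `h`. -/
def LiftsOnOpen {A Y K : PtdFibSpace B} (u : PtdFibMap A K) (h : PtdFibMap Y K)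
    (U : Set A.carrier) : Prop :=
  IsOpen U ∧ (∀ b, A.sec b ∈ U) ∧ Nonempty (LiftOn u h U)

/-- Maps on the subspace extend by junk values to total functions, and conversely restrict. -/
theorem isPtdSectional_iff {E X : PtdFibSpace B} {f : PtdFibMap E X} {U : Set X.carrier} :
    f.IsPtdSectional U ↔ LiftsOnOpen (id X) f U := by
  refine and_congr_right fun hUo => ⟨?_, ?_⟩
  · classical
    rintro ⟨hU, s, H, hp, h0, h1⟩
    have hs : ∀ x (hx : x ∈ U), (fun x => if hx : x ∈ U then s.toMap ⟨x, hx⟩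
        else E.sec (X.proj x)) x = s.toMap ⟨x, hx⟩ := fun x hx => dif_pos hx
    let H' : C((X.restrict U hU).carrier, C(I, X.carrier)) :=
      ContinuousMap.curry (X := (X.restrict U hU).carrier) (Y := I) H.toMap
    have hG : ∀ x (hx : x ∈ U), (fun x => if hx : x ∈ U then H' ⟨x, hx⟩
        else ContinuousMap.const I x) x = H' ⟨x, hx⟩ := fun x hx => dif_pos hx
    refine ⟨hU, ⟨⟨fun x => if hx : x ∈ U then s.toMap ⟨x, hx⟩ else E.sec (X.proj x),
      fun x => if hx : x ∈ U then H' ⟨x, hx⟩ else ContinuousMap.const I x, ?_, ?_, ?_, ?_, ?_,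
      ?_, ?_⟩⟩⟩
    · rw [continuousOn_iff_continuous_domRestrict]
      exact s.toMap.continuous.congr fun x => (hs x.1 x.2).symm
    · rw [continuousOn_iff_continuous_domRestrict]
      exact H'.continuous.congr fun x => (hG x.1 x.2).symm
    · intro x hx t
      exact (congrArg (fun c => X.proj (c t)) (hG x hx)).trans (H.proj_map (⟨x, hx⟩, t))
    · intro x hx
      exact (congrArg (fun c => c 0) (hG x hx)).trans (h0 ⟨x, hx⟩)
    · intro x hx
      exact (congrArg (fun c => c 1) (hG x hx)).trans
        ((h1 ⟨x, hx⟩).trans (congrArg f.toMap (hs x hx).symm))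
    · intro b
      exact (hs _ (hU b)).trans (s.map_sec b)
    · intro b t
      exact (congrArg (fun c => c t) (hG _ (hU b))).trans (hp b t)
  · rintro ⟨hU, ⟨l⟩⟩
    have hs := continuousOn_iff_continuous_domRestrict.1 l.continuousOn_s
    have hG := continuousOn_iff_continuous_domRestrict.1 l.continuousOn_G
    refine ⟨hU, ⟨⟨(⟨fun x : U => l.s x, hs⟩ : C(U, E.carrier)), fun x => l.proj_s x.2⟩, l.s_sec⟩,
      ⟨(⟨fun q : U × I => l.G q.1 q.2, ?_⟩ : C(U × I, X.carrier)),
        fun q => l.proj_G q.1.1 q.1.2 q.2⟩, l.G_sec,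
      fun x => l.G_zero x.1 x.2, fun x => l.G_one x.1 x.2⟩
    exact continuous_eval.comp ((hG.comp continuous_fst).prodMk continuous_snd)

/-- `C` is covered by `n + 1` open sets that contain the section and over which `u` lifts
through `h`. -/
def LiftCover {A Y K : PtdFibSpace B} (u : PtdFibMap A K) (h : PtdFibMap Y K) (n : ℕ)
    (C : Set A.carrier) : Prop :=
  ∃ U : ℕ → Set A.carrier, (∀ i ≤ n, LiftsOnOpen u h (U i)) ∧ C ⊆ ⋃ i ≤ n, U i

theorem secat_le_iff {E X : PtdFibSpace B} {f : PtdFibMap E X} {n : ℕ} :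
    f.secat ≤ n ↔ LiftCover (id X) f n Set.univ := by
  constructor
  · intro hn
    -- A strict bound on an infimum produces a member below it.
    have h' : f.secat < ((n + 1 : ℕ) : ℕ∞) := lt_of_le_of_lt hn (by exact_mod_cast n.lt_succ_self)
    simp only [secat, iInf_lt_iff] at h'
    obtain ⟨m, ⟨U, hU, hc⟩, hm⟩ := h'
    have hm : m < n + 1 := by exact_mod_cast hm
    -- Reducing indices modulo `m + 1` pads the cover with repetitions up to index `n`.
    refine ⟨fun i => U (Fin.ofNat (m + 1) i), fun i _ => isPtdSectional_iff.1 (hU _), fun x _ => ?_⟩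
    obtain ⟨i, hi⟩ := Set.mem_iUnion.1 (hc.ge (Set.mem_univ x))
    refine Set.mem_iUnion₂.2 ⟨i, by omega, ?_⟩
    simpa using hi
  · rintro ⟨U, hU, hc⟩
    refine iInf₂_le n ⟨fun i => U i, fun i => isPtdSectional_iff.2 (hU i (by omega)), ?_⟩
    refine Set.eq_univ_of_forall fun x => ?_
    obtain ⟨i, hi, hx⟩ := Set.mem_iUnion₂.1 (hc (Set.mem_univ x))
    exact Set.mem_iUnion.2 ⟨⟨i, by omega⟩, hx⟩

/-! ### Shrinking, extending and splitting covers -/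

section cover

variable {A Y K : PtdFibSpace B} {u : PtdFibMap A K} {h : PtdFibMap Y K} {C V W : Set A.carrier}
  {n : ℕ}

/-- Over a closed set, a cover by `n + 2` sets splits off its last member. -/
theorem LiftCover.shrink [NormalSpace A.carrier] (hA : IsClosed (Set.range A.sec))
    (hC : IsClosed C) (hc : LiftCover u h (n + 1) C) :
    ∃ V W, LiftsOnOpen u h V ∧ IsOpen W ∧ (∀ b, A.sec b ∈ W) ∧ LiftCover u h n (closure W) ∧
      C ⊆ W ∪ V := by
  obtain ⟨U, hU, hc⟩ := hc
  have hopen : IsOpen (⋃ i ≤ n, U i) :=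
    isOpen_biUnion fun i hi => (hU i (Nat.le_succ_of_le hi)).1
  -- The part of `C` missed by the last member is closed and lies in the union of the others. The
  -- section is added so that `W` contains it.
  obtain ⟨W, hW, hCW, hWU⟩ := normal_exists_closure_subset
    (s := (C \ U (n + 1)) ∪ Set.range A.sec) ((hC.sdiff (hU (n + 1) le_rfl).1).union hA) hopen (by
      rintro x (⟨hx, hx'⟩ | ⟨b, rfl⟩)
      · obtain ⟨i, hi, hxi⟩ := Set.mem_iUnion₂.1 (hc hx)
        refine Set.mem_iUnion₂.2 ⟨i, ?_, hxi⟩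
        by_contra hn
        obtain rfl : i = n + 1 := by omega
        exact hx' hxi
      · exact Set.mem_iUnion₂.2 ⟨0, n.zero_le, (hU 0 (by omega)).2.1 b⟩)
  refine ⟨U (n + 1), W, hU _ le_rfl, hW, fun b => hCW (Or.inr ⟨b, rfl⟩),
    ⟨U, fun i hi => hU i (by omega), hWU⟩, fun x hx => ?_⟩
  by_cases hx' : x ∈ U (n + 1)
  · exact Or.inr hx'
  · exact Or.inl (hCW (Or.inl ⟨hx, hx'⟩))

theorem LiftCover.nonempty_of_zero (hc : LiftCover u h 0 C) : Nonempty (LiftOn u h C) := by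
  obtain ⟨U, hU, hc⟩ := hc
  obtain ⟨l⟩ := (hU 0 le_rfl).2.2
  refine ⟨l.mono fun x hx => ?_⟩
  obtain ⟨i, hi, hx⟩ := Set.mem_iUnion₂.1 (hc hx)
  rwa [Nat.le_zero.1 hi] at hx

theorem LiftsOnOpen.liftCover_zero (hV : LiftsOnOpen u h V) : LiftCover u h 0 V :=
  ⟨fun _ => V, fun _ _ => hV, fun _ hx => Set.mem_iUnion₂.2 ⟨0, le_rfl, hx⟩⟩

theorem LiftCover.succ (hW : LiftCover u h n W) (hV : LiftsOnOpen u h V) (hC : C ⊆ W ∪ V) :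
    LiftCover u h (n + 1) C := by
  obtain ⟨U, hU, hc⟩ := hW
  refine ⟨fun i => if i ≤ n then U i else V, fun i _ => ?_, fun x hx => ?_⟩
  · dsimp only
    split_ifs with hi
    exacts [hU i hi, hV]
  · rcases hC hx with hx | hx
    · obtain ⟨i, hi, hx⟩ := Set.mem_iUnion₂.1 (hc hx)
      exact Set.mem_iUnion₂.2 ⟨i, by omega, by simpa only [if_pos hi] using hx⟩
    · exact Set.mem_iUnion₂.2 ⟨n + 1, le_rfl, by simpa using hx⟩

/-- A lift through a join over an open set splits into lifts through the two factors. -/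
theorem LiftsOnOpen.of_join {Z : PtdFibSpace B} {k : PtdFibMap Z K}
    (hC : LiftsOnOpen u (joinMap h k) C) :
    ∃ W V, LiftsOnOpen u h W ∧ LiftsOnOpen u k V ∧ C ⊆ W ∪ V := by
  obtain ⟨ho, hs, ⟨l⟩⟩ := hC
  refine ⟨_, _, ⟨l.continuousOn_s.isOpen_inter_preimage ho
      (isOpen_lt (LiftOn.joinHeight h k).continuous continuous_const), fun b => ⟨hs b, ?_⟩,
      ⟨l.trans (LiftOn.retractLeft h k)⟩⟩,
    ⟨l.continuousOn_s.isOpen_inter_preimage ho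
      (isOpen_lt continuous_const (LiftOn.joinHeight h k).continuous), fun b => ⟨hs b, ?_⟩,
      ⟨l.trans (LiftOn.retractRight h k)⟩⟩, fun x hx => ?_⟩
  -- The section of the join has height 1/2, hence lies in both halves.
  · change LiftOn.joinHeight h k (l.s (A.sec b)) < 1
    rw [l.s_sec]
    exact Subtype.coe_lt_coe.1 (show (1 / 2 : ℝ) < 1 by norm_num)
  · change 0 < LiftOn.joinHeight h k (l.s (A.sec b))
    rw [l.s_sec]
    exact Subtype.coe_lt_coe.1 (show (0 : ℝ) < 1 / 2 by norm_num)
  · rcases lt_or_ge (LiftOn.joinHeight h k (l.s x)) 1 with hx' | hx'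
    · exact Or.inl ⟨hx, hx'⟩
    · exact Or.inr ⟨hx, lt_of_lt_of_le zero_lt_one hx'⟩

end cover

/-! ### The inductions for Ganea maps and fat wedges -/

section main

variable {E X : PtdFibSpace B} {f : PtdFibMap E X}

/-- The closed set `C` varies in the induction: the inductive lift lives over `closure W` and is
then restricted to the open set `W` for gluing. -/
theorem LiftCover.nonempty_ganea [NormalSpace X.carrier] (hX : IsClosed (Set.range X.sec)) :
    ∀ (n : ℕ) {C : Set X.carrier}, IsClosed C → (∀ b, X.sec b ∈ C) →
      LiftCover (id X) f n C → Nonempty (LiftOn (id X) (f.ganeaMap n) C)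
  | 0, _, _, _, hc => hc.nonempty_of_zero
  | n + 1, C, hC, hs, hc => by
    obtain ⟨V, W, ⟨hVo, hVs, ⟨m⟩⟩, hWo, hWs, hW, hCW⟩ := hc.shrink hX hC
    obtain ⟨l⟩ := LiftCover.nonempty_ganea hX n isClosed_closure
      (fun b => subset_closure (hWs b)) hW
    exact LiftOn.nonempty_join hX (l.mono subset_closure) m hWo hVo hC hWs hVs hs hCW

/-- In each of the two product lifts, the component through an identity is stationary. -/
theorem LiftCover.nonempty_fatWedge [NormalSpace X.carrier] (hX : IsClosed (Set.range X.sec)) :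
    ∀ (n : ℕ) {C : Set X.carrier}, IsClosed C → (∀ b, X.sec b ∈ C) →
      LiftCover (id X) f n C → Nonempty (LiftOn (diag X n) (f.fatWedgeMap n) C)
  | 0, _, _, _, hc => hc.nonempty_of_zero
  | n + 1, C, hC, hs, hc => by
    obtain ⟨V, W, ⟨hVo, hVs, ⟨m⟩⟩, hWo, hWs, hW, hCW⟩ := hc.shrink hX hC
    obtain ⟨l⟩ := LiftCover.nonempty_fatWedge hX n isClosed_closure
      (fun b => subset_closure (hWs b)) hW
    exact LiftOn.nonempty_join hX (m.prod (LiftOn.refl (diag X n) V))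
      ((LiftOn.refl (id X) W).prod (l.mono subset_closure)) hVo hWo hC hVs hWs hs
      (Set.union_comm W V ▸ hCW)

/-- Stated for open subsets, because splitting a join leaves a lift through the previous Ganea map
over a smaller open set only. -/
theorem LiftsOnOpen.liftCover_of_ganea :
    ∀ (n : ℕ) {C : Set X.carrier}, LiftsOnOpen (id X) (f.ganeaMap n) C → LiftCover (id X) f n C
  | 0, _, hC => LiftsOnOpen.liftCover_zero hC
  | n + 1, C, hC => by
    obtain ⟨W, V, hW, hV, hCW⟩ := LiftsOnOpen.of_join (h := f.ganeaMap n) (k := f) hC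
    exact (LiftsOnOpen.liftCover_of_ganea n hW).succ hV hCW

theorem LiftsOnOpen.liftCover_of_fatWedge :
    ∀ (n : ℕ) {C : Set X.carrier}, LiftsOnOpen (diag X n) (f.fatWedgeMap n) C →
      LiftCover (id X) f n C
  | 0, _, hC => LiftsOnOpen.liftCover_zero hC
  | n + 1, C, hC => by
    obtain ⟨V, W, ⟨hVo, hVs, ⟨m⟩⟩, ⟨hWo, hWs, ⟨l⟩⟩, hCW⟩ := LiftsOnOpen.of_join
      (h := prodMap f (id (X.pow n))) (k := prodMap (id X) (f.fatWedgeMap n)) hC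
    exact (LiftsOnOpen.liftCover_of_fatWedge n
      ⟨hWo, hWs, ⟨LiftOn.snd (u := id X) (v := diag X n) l⟩⟩).succ
      ⟨hVo, hVs, ⟨LiftOn.fst (u := id X) (v := diag X n) m⟩⟩ (Set.union_comm V W ▸ hCW)

end main

end PtdFibMap

/-- The argument uses only that `X` is normal and that its section is closed. -/
theorem theorem3p7 {B : Type u} [TopologicalSpace B] {E X : PtdFibSpace B} (f : PtdFibMap E X)
    (hE : E.WellPointed) (hX : X.WellPointed)
    (hf : (NormalSpace E.carrier ∧ NormalSpace X.carrier) ∨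
      (f.IsClosedPtdCofibration ∧ NormalSpace X.carrier))
    (n : ℕ) :
    List.TFAE
      [f.secat ≤ (n : ℕ∞),
        ∃ φ : PtdFibMap X (f.fatWedge n),
          (PtdFibMap.diag X n).Homotopic ((f.fatWedgeMap n).comp φ),
        ∃ s : PtdFibMap X (f.ganea n),
          ((f.ganeaMap n).comp s).Homotopic (PtdFibMap.id X)] := by
  have : NormalSpace X.carrier := hf.elim (fun h => h.2) fun h => h.2
  have hsec : IsClosed (Set.range X.sec) := hX.1.isClosed_range
  -- Lifts start at `u`, so the homotopy in the third statement has to be reversed.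
  have hsymm : (∃ s : PtdFibMap X (f.ganea n),
      ((f.ganeaMap n).comp s).Homotopic (PtdFibMap.id X)) ↔
      ∃ s : PtdFibMap X (f.ganea n), (PtdFibMap.id X).Homotopic ((f.ganeaMap n).comp s) :=
    exists_congr fun _ => ⟨fun h => h.symm, fun h => h.symm⟩
  rw [hsymm, PtdFibMap.secat_le_iff, ← PtdFibMap.nonempty_liftOn_univ_iff,
    ← PtdFibMap.nonempty_liftOn_univ_iff]
  tfae_have 1 → 2 := PtdFibMap.LiftCover.nonempty_fatWedge hsec n isClosed_univ fun _ => trivial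
  tfae_have 1 → 3 := PtdFibMap.LiftCover.nonempty_ganea hsec n isClosed_univ fun _ => trivial
  tfae_have 2 → 1 := fun h =>
    PtdFibMap.LiftsOnOpen.liftCover_of_fatWedge n ⟨isOpen_univ, fun _ => trivial, h⟩
  tfae_have 3 → 1 := fun h =>
    PtdFibMap.LiftsOnOpen.liftCover_of_ganea n ⟨isOpen_univ, fun _ => trivial, h⟩
  tfae_finish
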